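/- For $c>0$ and $x\in\mathbb{R}\setminus\mathbb{Q}$ consider the inequality $$\left|x-\frac pq\right|<\frac1{cq^2}\qquad(\ast)_c$$ where a rational solution is a rational number $p/q$ with $p\in\mathbb{Z}$, $q\geq 1$, $\gcd(p,q)=1$ (so each rational number is counted once). The Lagrange value of $x$ is $$k(x)=\sup\{c>0 : (\ast)_c \text{ has infinitely many rational solutions}\}\in(0,\infty].$$ For $n\in\mathbb{N}\cup\{\infty\}$, where $\mathbb{N}=\{0,1,2,\dots\}$, let $X_3(n)$ be the set of all $x\in\mathbb{R}\setminus\mathbb{Q}$ such that $k(x)=3$ and $\left|x-\frac pq\right|<\frac1{3q^2}$ has exactly $n$ rational solutions (infinitely many if $n=\infty$). Then for every $n\in\mathbb{N}\cup\{\infty\}$ the set $X_3(n)$ is uncountable. Consequently, the set $X_3$ of all $x\in\mathbb{R}\setminus\mathbb{Q}$ for which $\left|x-\frac pq\right|<\frac1{3q^2}$ has only finitely many rational solutions is uncountable. -/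

import Mathlib

/-- The rational solutions `p/q` of `|x - p/q| < 1/(c q²)`. Each rational number is counted once,
with `q` its reduced denominator. (A rational number satisfies the inequality for some
representation `p/q` if and only if it does so for the reduced one.) -/
def ratSolutions (c x : ℝ) : Set ℚ :=
  {r : ℚ | |x - (r : ℝ)| < 1 / (c * (r.den : ℝ) ^ 2)}

/-- The Lagrange value `k(x)`: the supremum, in the extended reals, of all `c > 0` for which
`|x - p/q| < 1/(c q²)` has infinitely many rational solutions. -/
noncomputable def lagrangeValue (x : ℝ) : EReal :=
  sSup ((fun c : ℝ => (c : EReal)) '' {c : ℝ | 0 < c ∧ (ratSolutions c x).Infinite})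

/-- The set `X_c` of irrationals `x` for which `|x - p/q| < 1/(c q²)` has only finitely many
rational solutions. -/
def finSolSet (c : ℝ) : Set ℝ :=
  {x : ℝ | Irrational x ∧ (ratSolutions c x).Finite}

/-- The set `X_3(n)`, `n ∈ ℕ ∪ {∞}`, of irrationals `x` with Lagrange value `3` for which
`|x - p/q| < 1/(3 q²)` has exactly `n` rational solutions. -/
def exactSolSet (n : ℕ∞) : Set ℝ :=
  {x : ℝ | Irrational x ∧ lagrangeValue x = 3 ∧ (ratSolutions 3 x).encard = n}

/-!
Replace every letter `0` of a word `w` by the partial quotients `1, 1` and every letter `1` by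
`2, 2`, and let `x = [a₀; a₁, …]` be a continued fraction that ends in this way. For `c ≥ 2` only
convergents can solve the inequality, and the `k`-th convergent satisfies
`|x - p/q| = 1 / (λ q²)` with `λ = [aₖ₊₁; aₖ₊₂, …] + [0; aₖ, …, a₁]`. Next to a pair `1, 1` one has
`λ < 3`. Inside a pair `2, 2` the sign of `λ - 3` is decided by the first place where `w` is not
mirror symmetric. If `w` is balanced, such a mismatch always gives `λ < 3`, so `λ ≥ 3` is possible
only where a prefix `u 0 1 uʳ` of `w` is symmetric up to its very beginning; there
`|λ - 3| ≤ 4 ^ (-|u| - 1)`.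

The mechanical word of an irrational slope `α` has infinitely many such prefixes: they come from
the best approximations of `α` from above. Hence the Lagrange value of `x` is `3`. At these
prefixes the sign of `λ - 3` depends only on the partial quotients in front of the coded word: a
single `1` makes `λ > 3` throughout, while `n` partial quotients `3` give `λ < 3` throughout and
add exactly `n` convergents with `λ > 3`. Distinct slopes give distinct `x`.
-/

open Set Filter

/-! ### Continued fractions and their convergents -/

/-- `R k = [A k; A (k + 1), …]` are the complete quotients of the infinite continued fraction with
partial quotients `A`. -/
structure IsCompleteQuotients (A : ℕ → ℕ) (R : ℕ → ℝ) : Prop where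
  one_lt : ∀ k, 1 < R k
  eq_add_inv : ∀ k, R k = A k + (R (k + 1))⁻¹

/-- The finite continued fraction `[0; A k, …, A (k + N - 1)]`. -/
noncomputable def truncTail (A : ℕ → ℕ) : ℕ → ℕ → ℝ
  | 0, _ => 0
  | N + 1, k => (A k + truncTail A N (k + 1))⁻¹

theorem truncTail_mem_Icc {A : ℕ → ℕ} (hA : ∀ k, 1 ≤ A k) (N k : ℕ) :
    truncTail A N k ∈ Icc (0 : ℝ) 1 := by
  induction N generalizing k with
  | zero => simp [truncTail]
  | succ N ih =>
    have hAk : (1 : ℝ) ≤ A k := by exact_mod_cast hA k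
    have htail := (ih (k + 1)).1
    exact ⟨by rw [truncTail]; positivity, inv_le_one_of_one_le₀ (by linarith)⟩

theorem exists_mul_add_succ_eq_one {A : ℕ → ℕ} (hA : ∀ k, 1 ≤ A k) :
    ∃ ξ : ℕ → ℝ, ∀ k, ξ k ∈ Icc (0 : ℝ) 1 ∧ ξ k * (A k + ξ (k + 1)) = 1 := by
  let C : ℕ → Set (ℕ → ℝ) := fun N =>
    univ.pi (fun _ => Icc 0 1) ∩ {ξ | ∀ k < N, ξ k * (A k + ξ (k + 1)) = 1}
  have hbox : IsCompact (univ.pi fun _ : ℕ => Icc (0 : ℝ) 1) :=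
    isCompact_univ_pi fun _ => isCompact_Icc
  have hclosed (N : ℕ) : IsClosed {ξ : ℕ → ℝ | ∀ k < N, ξ k * (A k + ξ (k + 1)) = 1} := by
    simp only [ofPred_forall]
    exact isClosed_iInter fun k => isClosed_iInter fun _ =>
      isClosed_eq (by fun_prop) continuous_const
  have hne (N : ℕ) : (C N).Nonempty := by
    refine ⟨fun k => truncTail A (N - k) k, fun k _ => truncTail_mem_Icc hA _ _, fun k hk => ?_⟩
    obtain ⟨j, rfl⟩ := Nat.exists_eq_add_of_lt hk
    have hAk : (1 : ℝ) ≤ A k := by exact_mod_cast hA k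
    have htail := (truncTail_mem_Icc hA j (k + 1)).1
    simp only [show k + j + 1 - k = j + 1 by omega, show k + j + 1 - (k + 1) = j by omega,
      truncTail]
    exact inv_mul_cancel₀ (by positivity)
  obtain ⟨ξ, hξ⟩ := IsCompact.nonempty_iInter_of_sequence_nonempty_isCompact_isClosed C
    (fun N => inter_subset_inter_right _ fun ξ hξ k hk => hξ k (hk.trans N.lt_succ_self)) hne
    (hbox.inter_right (hclosed 0)) fun N => hbox.isClosed.inter (hclosed N)
  rw [mem_iInter] at hξ
  exact ⟨ξ, fun k => ⟨(hξ 0).1 k trivial, (hξ (k + 1)).2 k k.lt_succ_self⟩⟩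

theorem exists_isCompleteQuotients {A : ℕ → ℕ} (hA : ∀ k, 1 ≤ A k) :
    ∃ R, IsCompleteQuotients A R := by
  obtain ⟨ξ, hξ⟩ := exists_mul_add_succ_eq_one hA
  have hinv (k : ℕ) : (ξ k)⁻¹ = A k + ξ (k + 1) := inv_eq_of_mul_eq_one_right (hξ k).2
  have hpos (k : ℕ) : 0 < ξ k :=
    (hξ k).1.1.lt_of_ne' (left_ne_zero_of_mul_eq_one (hξ k).2)
  refine ⟨fun k => (ξ k)⁻¹, fun k => ?_, fun k => by rw [inv_inv, hinv]⟩
  have hAk : (1 : ℝ) ≤ A k := by exact_mod_cast hA k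
  rw [hinv]
  linarith [hpos (k + 1)]

namespace IsCompleteQuotients

variable {A B : ℕ → ℕ} {R S : ℕ → ℝ}

theorem pos (h : IsCompleteQuotients A R) (k : ℕ) : 0 < R k := one_pos.trans (h.one_lt k)

theorem inv_pos (h : IsCompleteQuotients A R) (k : ℕ) : 0 < (R k)⁻¹ := _root_.inv_pos.2 (h.pos k)

theorem inv_lt_one (h : IsCompleteQuotients A R) (k : ℕ) : (R k)⁻¹ < 1 :=
  inv_lt_one_of_one_lt₀ (h.one_lt k)

theorem tail (h : IsCompleteQuotients A R) :
    IsCompleteQuotients (fun k => A (k + 1)) fun k => R (k + 1) :=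
  ⟨fun k => h.one_lt (k + 1), fun k => h.eq_add_inv (k + 1)⟩

theorem floor_eq (h : IsCompleteQuotients A R) (k : ℕ) : ⌊R k⌋ = A k := by
  rw [Int.floor_eq_iff, h.eq_add_inv k, Int.cast_natCast]
  constructor <;> linarith [h.inv_pos (k + 1), h.inv_lt_one (k + 1)]

theorem one_le (h : IsCompleteQuotients A R) (k : ℕ) : 1 ≤ A k := by
  have : (1 : ℤ) ≤ ⌊R k⌋ := Int.le_floor.2 (by exact_mod_cast (h.one_lt k).le)
  rw [h.floor_eq] at this
  exact_mod_cast this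

theorem inv_fract_eq (h : IsCompleteQuotients A R) (k : ℕ) : (Int.fract (R k))⁻¹ = R (k + 1) := by
  rw [← Int.self_sub_floor, h.floor_eq, h.eq_add_inv k, Int.cast_natCast, add_sub_cancel_left,
    inv_inv]

theorem eq_of_zero_eq (hA : IsCompleteQuotients A R) (hB : IsCompleteQuotients B S)
    (h0 : R 0 = S 0) : A = B := by
  have hRS (k : ℕ) : R k = S k := by
    induction k with
    | zero => exact h0
    | succ k ih => rw [← hA.inv_fract_eq, ← hB.inv_fract_eq, ih]
  funext k
  have hfloor := hA.floor_eq k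
  rw [hRS, hB.floor_eq] at hfloor
  exact_mod_cast hfloor.symm

theorem mul_add_eq (h : IsCompleteQuotients A R) (k : ℕ) (a b : ℝ) :
    R (k + 1) * (A k * b + a) + b = R (k + 1) * (R k * b + a) := by
  rw [h.eq_add_inv k]
  field_simp [(h.pos (k + 1)).ne']
  ring

end IsCompleteQuotients

/-- Numerators of the convergents of `[A 0; A 1, …]`; the index is shifted by one, so that the
recurrence starts from the formal convergent `1 / 0`. -/
def convNum (A : ℕ → ℕ) : ℕ → ℕ
  | 0 => 1
  | 1 => A 0
  | k + 2 => A (k + 1) * convNum A (k + 1) + convNum A k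

/-- Denominators of the convergents of `[A 0; A 1, …]`, with the same shift as `convNum`. -/
def convDen (A : ℕ → ℕ) : ℕ → ℕ
  | 0 => 0
  | 1 => 1
  | k + 2 => A (k + 1) * convDen A (k + 1) + convDen A k

/-- The finite continued fraction `[0; A k, …, A 1]`. -/
noncomputable def backQuot (A : ℕ → ℕ) : ℕ → ℝ
  | 0 => 0
  | k + 1 => (A (k + 1) + backQuot A k)⁻¹

/-- The quantity `λ` with `|x - p/q| = 1 / (λ q²)` for the `k`-th convergent `p/q` of `x`. -/
noncomputable def approxConst (A : ℕ → ℕ) (R : ℕ → ℝ) (k : ℕ) : ℝ := R (k + 1) + backQuot A k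

theorem convDen_succ_eq (A : ℕ → ℕ) (k : ℕ) :
    convDen A (k + 1) = convNum (fun i => A (i + 1)) k := by
  induction k using Nat.twoStepInduction with
  | zero => rfl
  | one => simp [convDen, convNum]
  | more k ih₀ ih₁ => rw [convDen, convNum, ih₀, ih₁]

theorem convNum_succ_eq (A : ℕ → ℕ) (k : ℕ) :
    convNum A (k + 1) =
      A 0 * convNum (fun i => A (i + 1)) k + convDen (fun i => A (i + 1)) k := by
  induction k using Nat.twoStepInduction with
  | zero => simp [convDen, convNum]
  | one => simp [convDen, convNum]; ring
  | more k ih₀ ih₁ => rw [convNum, ih₀, ih₁, convNum, convDen]; ring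

theorem coprime_convNum_convDen (A : ℕ → ℕ) (k : ℕ) : (convNum A k).Coprime (convDen A k) := by
  induction k generalizing A with
  | zero => simp [convNum, convDen]
  | succ k ih =>
    rw [convNum_succ_eq, convDen_succ_eq, Nat.coprime_mul_right_add_left]
    exact (ih _).symm

theorem convNum_mul_convDen_sub (A : ℕ → ℕ) (k : ℕ) :
    (convNum A k * convDen A (k + 1) - convNum A (k + 1) * convDen A k : ℝ) = (-1) ^ k := by
  induction k with
  | zero => simp [convNum, convDen]
  | succ k ih =>
    rw [convNum, convDen, pow_succ, ← ih]
    push_cast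
    ring

theorem backQuot_nonneg (A : ℕ → ℕ) (k : ℕ) : 0 ≤ backQuot A k := by
  induction k with
  | zero => rfl
  | succ k ih => rw [backQuot]; positivity

namespace IsCompleteQuotients

variable {A : ℕ → ℕ} {R : ℕ → ℝ}

theorem convDen_succ_pos (h : IsCompleteQuotients A R) (k : ℕ) : 0 < convDen A (k + 1) := by
  induction k with
  | zero => exact one_pos
  | succ k ih => exact Nat.add_pos_left (Nat.mul_pos (h.one_le (k + 1)) ih) _

theorem convDen_succ_le (h : IsCompleteQuotients A R) (k : ℕ) :
    convDen A (k + 1) ≤ convDen A (k + 2) :=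
  (Nat.le_mul_of_pos_left _ (h.one_le (k + 1))).trans (Nat.le_add_right _ _)

theorem convergent_eq (h : IsCompleteQuotients A R) (k : ℕ) :
    (R 0).convergent k = (convNum A (k + 1) : ℚ) / convDen A (k + 1) := by
  induction k generalizing A R with
  | zero => simp [Real.convergent_zero, h.floor_eq, convNum, convDen]
  | succ k ih =>
    have hpos : (convNum (fun i => A (i + 1)) (k + 1) : ℚ) ≠ 0 := by
      exact_mod_cast (convDen_succ_eq A (k + 1) ▸ h.convDen_succ_pos (k + 1)).ne'
    rw [Real.convergent_succ, h.floor_eq, h.inv_fract_eq, ih h.tail, convNum_succ_eq A (k + 1),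
      convDen_succ_eq A (k + 1)]
    push_cast
    field_simp

theorem den_convergent (h : IsCompleteQuotients A R) (k : ℕ) :
    ((R 0).convergent k).den = convDen A (k + 1) := by
  rw [h.convergent_eq]
  have hden := Rat.den_div_eq_of_coprime (a := convNum A (k + 1)) (b := convDen A (k + 1))
    (by exact_mod_cast h.convDen_succ_pos k) (coprime_convNum_convDen A (k + 1))
  rw [Int.cast_natCast, Int.cast_natCast] at hden
  exact_mod_cast hden

theorem zero_mul_eq (h : IsCompleteQuotients A R) (k : ℕ) :
    R 0 * (R (k + 1) * convDen A (k + 1) + convDen A k) =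
      R (k + 1) * convNum A (k + 1) + convNum A k := by
  induction k with
  | zero =>
    have := h.mul_add_eq 0 0 1
    simp only [convDen, convNum, Nat.cast_zero, Nat.cast_one] at this ⊢
    linarith
  | succ k ih =>
    rw [convDen, convNum]
    push_cast
    rw [h.mul_add_eq, h.mul_add_eq, ← ih]
    ring

theorem backQuot_eq (h : IsCompleteQuotients A R) (k : ℕ) :
    backQuot A k = (convDen A k : ℝ) / convDen A (k + 1) := by
  induction k with
  | zero => simp [backQuot, convDen]
  | succ k ih =>
    have hq : (convDen A (k + 1) : ℝ) ≠ 0 := by exact_mod_cast (h.convDen_succ_pos k).ne'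
    rw [backQuot, ih, convDen]
    push_cast
    field_simp

theorem approxConst_mul_sq (h : IsCompleteQuotients A R) (k : ℕ) :
    approxConst A R k * (convDen A (k + 1) : ℝ) ^ 2 =
      convDen A (k + 1) * (R (k + 1) * convDen A (k + 1) + convDen A k) := by
  have hq : (convDen A (k + 1) : ℝ) ≠ 0 := by exact_mod_cast (h.convDen_succ_pos k).ne'
  rw [approxConst, h.backQuot_eq]
  field_simp

theorem one_lt_approxConst (h : IsCompleteQuotients A R) (k : ℕ) : 1 < approxConst A R k :=
  lt_add_of_lt_of_nonneg (h.one_lt (k + 1)) (backQuot_nonneg A k)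

theorem abs_sub_convergent (h : IsCompleteQuotients A R) (k : ℕ) :
    |R 0 - (R 0).convergent k| =
      (approxConst A R k * (((R 0).convergent k).den : ℝ) ^ 2)⁻¹ := by
  have hq : (0 : ℝ) < convDen A (k + 1) := by exact_mod_cast h.convDen_succ_pos k
  have hD : 0 < R (k + 1) * convDen A (k + 1) + convDen A k := by
    have := h.pos (k + 1)
    positivity
  have hsub : R 0 - (convNum A (k + 1) : ℝ) / convDen A (k + 1) =
      (-1) ^ k / (convDen A (k + 1) * (R (k + 1) * convDen A (k + 1) + convDen A k)) := by
    rw [← convNum_mul_convDen_sub A k, eq_div_iff (by positivity)]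
    field_simp
    linear_combination (convDen A (k + 1) : ℝ) * h.zero_mul_eq k
  rw [h.den_convergent, h.approxConst_mul_sq, h.convergent_eq]
  push_cast
  rw [hsub, abs_div, abs_neg_one_pow, abs_of_pos (by positivity), one_div]

theorem strictMono_approxConst_mul_sq (h : IsCompleteQuotients A R) :
    StrictMono fun k => approxConst A R k * (convDen A (k + 1) : ℝ) ^ 2 := by
  refine strictMono_nat_of_lt_succ fun k => ?_
  have hq : (0 : ℝ) < convDen A (k + 1) := by exact_mod_cast h.convDen_succ_pos k
  have hq' : (convDen A (k + 1) : ℝ) ≤ convDen A (k + 2) := by exact_mod_cast h.convDen_succ_le k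
  have hD : 0 < R (k + 1) * convDen A (k + 1) + convDen A k := by
    have := h.pos (k + 1)
    positivity
  rw [h.approxConst_mul_sq, h.approxConst_mul_sq]
  refine mul_lt_mul_of_le_of_lt_of_nonneg_of_pos hq' ?_ hD.le (hq.trans_le hq')
  rw [convDen]
  push_cast
  rw [h.mul_add_eq]
  exact lt_mul_of_one_lt_left hD (h.one_lt (k + 2))

theorem convergent_injective (h : IsCompleteQuotients A R) :
    Function.Injective (R 0).convergent := by
  intro i j hij
  apply h.strictMono_approxConst_mul_sq.injective
  simpa only [h.abs_sub_convergent, h.den_convergent, inv_inj] using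
    congrArg (fun r : ℚ => |R 0 - r|) hij

theorem abs_sub_convergent_lt_iff (h : IsCompleteQuotients A R) {c : ℝ} (hc : 0 < c) (k : ℕ) :
    |R 0 - (R 0).convergent k| < 1 / (c * (((R 0).convergent k).den : ℝ) ^ 2) ↔
      c < approxConst A R k := by
  have hden : 0 < (((R 0).convergent k).den : ℝ) ^ 2 := by
    have := ((R 0).convergent k).pos
    positivity
  have hlam := one_pos.trans (h.one_lt_approxConst k)
  rw [h.abs_sub_convergent, one_div, inv_lt_inv₀ (by positivity) (by positivity),
    mul_lt_mul_iff_of_pos_right hden]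

theorem irrational (h : IsCompleteQuotients A R) : Irrational (R 0) := by
  rw [← Real.infinite_rat_abs_sub_lt_one_div_den_sq_iff_irrational]
  refine (infinite_range_of_injective h.convergent_injective).mono ?_
  rintro _ ⟨k, rfl⟩
  simpa only [mem_ofPred_eq, one_mul] using
    (h.abs_sub_convergent_lt_iff one_pos k).2 (h.one_lt_approxConst k)

theorem ratSolutions_eq (h : IsCompleteQuotients A R) {c : ℝ} (hc : 2 ≤ c) :
    ratSolutions c (R 0) = (R 0).convergent '' {k | c < approxConst A R k} := by
  have hc0 : 0 < c := by linarith
  ext r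
  constructor
  · intro hr
    have hlegendre : |R 0 - r| < 1 / (2 * (r.den : ℝ) ^ 2) := by
      have := r.pos
      exact lt_of_lt_of_le hr (by gcongr)
    obtain ⟨k, rfl⟩ := Real.exists_rat_eq_convergent hlegendre
    exact ⟨k, (h.abs_sub_convergent_lt_iff hc0 k).1 hr, rfl⟩
  · rintro ⟨k, hk, rfl⟩
    exact (h.abs_sub_convergent_lt_iff hc0 k).2 hk

theorem infinite_ratSolutions_iff (h : IsCompleteQuotients A R) {c : ℝ} (hc : 2 ≤ c) :
    (ratSolutions c (R 0)).Infinite ↔ {k | c < approxConst A R k}.Infinite := by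
  rw [h.ratSolutions_eq hc, infinite_image_iff h.convergent_injective.injOn]

theorem encard_ratSolutions (h : IsCompleteQuotients A R) {c : ℝ} (hc : 2 ≤ c) :
    (ratSolutions c (R 0)).encard = {k | c < approxConst A R k}.encard := by
  rw [h.ratSolutions_eq hc, h.convergent_injective.encard_image]

theorem lagrangeValue_eq (h : IsCompleteQuotients A R) {c : ℝ} (hc : 2 < c)
    (hinf : ∀ b < c, {k | b < approxConst A R k}.Infinite)
    (hfin : ∀ b > c, {k | b < approxConst A R k}.Finite) : lagrangeValue (R 0) = c := by
  apply le_antisymm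
  · refine sSup_le ?_
    rintro _ ⟨b, ⟨-, hb⟩, rfl⟩
    refine EReal.coe_le_coe_iff.2 (not_lt.1 fun hcb => ?_)
    exact (h.infinite_ratSolutions_iff (hc.trans hcb).le).1 hb (hfin b hcb)
  · refine le_of_forall_lt fun y hy => ?_
    obtain ⟨b, hyb, hbc⟩ := EReal.lt_iff_exists_real_btwn.1 hy
    have hmax : max b 2 < c := max_lt (EReal.coe_lt_coe_iff.1 hbc) hc
    refine hyb.trans_le ((EReal.coe_le_coe_iff.2 (le_max_left b 2)).trans (le_sSup ?_))
    exact ⟨_, ⟨by positivity, (h.infinite_ratSolutions_iff (le_max_right b 2)).2 (hinf _ hmax)⟩,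
      rfl⟩

end IsCompleteQuotients

/-! ### Balanced words and palindromic ascents -/

/-- The sum of the first `n` letters of a word. -/
def prefixSum (w : ℕ → ℕ) (n : ℕ) : ℕ := ∑ i ∈ Finset.range n, w i

theorem prefixSum_succ (w : ℕ → ℕ) (n : ℕ) : prefixSum w (n + 1) = prefixSum w n + w n :=
  Finset.sum_range_succ _ _

/-- Balanced words that start with a zero, in the normalization where every factor of length `n`
has the letter sum of the prefix of length `n`, or one more. -/
structure IsBalancedWord (w : ℕ → ℕ) : Prop where
  zero : w 0 = 0
  add_le : ∀ m n, prefixSum w m + prefixSum w n ≤ prefixSum w (m + n)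
  le_add : ∀ m n, prefixSum w (m + n) ≤ prefixSum w m + prefixSum w n + 1

/-- The factor of `w` on the positions `a, …, a + 2 * J + 1` reads the same in both directions,
except possibly for its two middle letters `w (a + J)` and `w (a + J + 1)`. -/
def IsMirror (w : ℕ → ℕ) (a J : ℕ) : Prop :=
  ∀ s t, a ≤ s → s < a + J → s + t = 2 * (a + J) + 1 → w s = w t

/-- A prefix `u 0 1 uʳ` of the word `w`, where `uʳ` is the reversal of `u` and `u` has length `m`.
These are the only places where a continued fraction coded by `w` can have an approximation
constant of at least `3`. -/
def IsPalindromicAscent (w : ℕ → ℕ) (m : ℕ) : Prop :=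
  w m = 0 ∧ w (m + 1) = 1 ∧ IsMirror w 0 m

section Mirror

variable {w : ℕ → ℕ} {a J : ℕ}

theorem IsMirror.outer_eq (h : IsMirror w a (J + 1)) : w a = w (a + 2 * J + 3) :=
  h _ _ le_rfl (by omega) (by omega)

theorem IsMirror.inner (h : IsMirror w a (J + 1)) : IsMirror w (a + 1) J :=
  fun _ _ hs hs' hst => h _ _ (by omega) (by omega) (by omega)

theorem IsMirror.extend (h : IsMirror w (a + 1) J) (heq : w a = w (a + 2 * J + 3)) :
    IsMirror w a (J + 1) := by
  intro s t hs hs' hst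
  rcases hs.eq_or_lt with rfl | hlt
  · rw [heq]
    congr 1
    omega
  · exact h _ _ hlt (by omega) (by omega)

theorem IsMirror.prefixSum_add (h : IsMirror w a J) :
    prefixSum w (a + J) + prefixSum w (a + J + 2) =
      prefixSum w a + prefixSum w (a + 2 * J + 2) := by
  induction J generalizing a with
  | zero => rfl
  | succ J ih =>
    have hinner := ih h.inner
    have hleft := prefixSum_succ w a
    have hright := prefixSum_succ w (a + 2 * J + 3)
    rw [show a + 1 + J = a + (J + 1) by ring, show a + 1 + 2 * J + 2 = a + 2 * J + 3 by ring]
      at hinner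
    rw [show a + 2 * (J + 1) + 2 = a + 2 * J + 3 + 1 by ring, hright, ← h.outer_eq]
    omega

theorem IsMirror.extend_or_exists_mismatch (h : IsMirror w a J) :
    IsMirror w 0 (a + J) ∨
      ∃ s K, s + 1 + K = a + J ∧ IsMirror w (s + 1) K ∧ w s ≠ w (s + 2 * K + 3) := by
  induction a generalizing J with
  | zero => exact Or.inl (by rwa [zero_add])
  | succ a ih =>
    by_cases heq : w a = w (a + 2 * J + 3)
    · simpa only [add_right_comm, add_assoc] using ih (h.extend heq)
    · exact Or.inr ⟨a, J, rfl, h, heq⟩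

theorem isMirror_or_exists_mismatch (w : ℕ → ℕ) (m : ℕ) :
    IsMirror w 0 m ∨ ∃ s K, s + 1 + K = m ∧ IsMirror w (s + 1) K ∧ w s ≠ w (s + 2 * K + 3) :=
  IsMirror.extend_or_exists_mismatch (J := 0) fun _ _ hs hs' _ => absurd hs' hs.not_gt

end Mirror

namespace IsBalancedWord

variable {w : ℕ → ℕ}

theorem le_one (h : IsBalancedWord w) (n : ℕ) : w n ≤ 1 := by
  have hle := h.le_add n 1
  have hone : prefixSum w 1 = 0 := by rw [prefixSum, Finset.sum_range_one, h.zero]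
  rw [prefixSum_succ] at hle
  omega

theorem eq_zero_or_one (h : IsBalancedWord w) (n : ℕ) : w n = 0 ∨ w n = 1 :=
  Nat.le_one_iff_eq_zero_or_eq_one.1 (h.le_one n)

theorem prefixSum_window_le (h : IsBalancedWord w) (i j n : ℕ) :
    prefixSum w (i + n) + prefixSum w j ≤ prefixSum w (j + n) + prefixSum w i + 1 := by
  have := h.le_add i n
  have := h.add_le j n
  omega

theorem letters_le_of_isMirror (h : IsBalancedWord w) {s K : ℕ} (hm : IsMirror w (s + 1) K) :
    w s + w (s + 1 + K) ≤ w (s + K + 2) + w (s + 2 * K + 3) + 1 ∧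
      w (s + K + 2) + w (s + 2 * K + 3) ≤ w s + w (s + 1 + K) + 1 := by
  have hsum := hm.prefixSum_add
  have hle := h.prefixSum_window_le s (s + K + 2) (K + 2)
  have hge := h.prefixSum_window_le (s + K + 2) s (K + 2)
  have hs := prefixSum_succ w s
  have hc := prefixSum_succ w (s + 1 + K)
  have hc' := prefixSum_succ w (s + K + 2)
  have ht := prefixSum_succ w (s + 2 * K + 3)
  ring_nf at hsum hle hge hs hc hc' ht ⊢
  omega

theorem mismatch_of_ascent (h : IsBalancedWord w) {m : ℕ} (h0 : w m = 0) (h1 : w (m + 1) = 1) :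
    IsPalindromicAscent w m ∨
      ∃ s K, s + 1 + K = m ∧ IsMirror w (s + 1) K ∧ w s = 1 ∧ w (s + 2 * K + 3) = 0 := by
  refine (isMirror_or_exists_mismatch w m).imp (fun hm => ⟨h0, h1, hm⟩) ?_
  rintro ⟨s, K, rfl, hm, hne⟩
  have := (h.letters_le_of_isMirror hm).2
  have := h.le_one s
  have := h.le_one (s + 2 * K + 3)
  rw [show s + 1 + K + 1 = s + K + 2 by ring] at h1
  exact ⟨s, K, rfl, hm, by omega, by omega⟩

theorem mismatch_of_descent (h : IsBalancedWord w) {m : ℕ} (h1 : w m = 1) (h0 : w (m + 1) = 0) :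
    ∃ s K, s + 1 + K = m ∧ IsMirror w (s + 1) K ∧ w s = 0 ∧ w (s + 2 * K + 3) = 1 := by
  rcases isMirror_or_exists_mismatch w m with hm | ⟨s, K, rfl, hm, hne⟩
  · have hsum := hm.prefixSum_add
    have hsuper := h.add_le (m + 1) (m + 1)
    rw [zero_add, show 0 + 2 * m + 2 = m + 1 + (m + 1) by ring, prefixSum_succ w (m + 1)] at hsum
    have := prefixSum_succ w m
    have : prefixSum w 0 = 0 := rfl
    omega
  · have := (h.letters_le_of_isMirror hm).1
    have := h.le_one s
    have := h.le_one (s + 2 * K + 3)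
    rw [show s + 1 + K + 1 = s + K + 2 by ring] at h0
    exact ⟨s, K, rfl, hm, by omega, by omega⟩

end IsBalancedWord

/-- The lower mechanical word of slope `α` and intercept `0`. -/
noncomputable def mechWord (α : ℝ) (i : ℕ) : ℕ := ⌊((i + 1 : ℕ) : ℝ) * α⌋₊ - ⌊(i : ℝ) * α⌋₊

section MechWord

variable {α : ℝ}

theorem prefixSum_mechWord (hα : 0 ≤ α) (n : ℕ) : prefixSum (mechWord α) n = ⌊(n : ℝ) * α⌋₊ := by
  have hmono : Monotone fun k : ℕ => ⌊(k : ℝ) * α⌋₊ := fun i j hij =>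
    Nat.floor_le_floor (by gcongr)
  simpa [prefixSum, mechWord] using Finset.sum_range_tsub hmono n

theorem cast_prefixSum_mechWord (hα : 0 ≤ α) (n : ℕ) :
    (prefixSum (mechWord α) n : ℤ) = ⌊(n : ℝ) * α⌋ := by
  rw [prefixSum_mechWord hα, Int.natCast_floor_eq_floor (by positivity)]

theorem isBalancedWord_mechWord (hα : α ∈ Ioo (0 : ℝ) 1) : IsBalancedWord (mechWord α) := by
  refine ⟨?_, fun m n => ?_, fun m n => ?_⟩
  · simp [mechWord, Nat.floor_eq_zero.2 hα.2]
  · zify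
    simp only [cast_prefixSum_mechWord hα.1.le, Nat.cast_add, add_mul]
    exact Int.le_floor_add _ _
  · zify
    simp only [cast_prefixSum_mechWord hα.1.le, Nat.cast_add, add_mul]
    linarith [Int.le_floor_add_floor ((m : ℝ) * α) (n * α)]

theorem mechWord_injOn : InjOn mechWord (Ici 0) := by
  intro α hα β hβ h
  have hlim {γ : ℝ} (hγ : 0 ≤ γ) :
      Tendsto (fun n : ℕ => (prefixSum (mechWord γ) n : ℝ) / n) atTop (nhds γ) := by
    simp only [prefixSum_mechWord hγ, mul_comm _ γ]
    exact (tendsto_nat_floor_mul_div_atTop hγ).comp tendsto_natCast_atTop_atTop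
  exact tendsto_nhds_unique (hlim hα) (h ▸ hlim hβ)

/-- `m / n` is a best rational approximation of the second kind to `α`, that is `|n α - m|` is
minimal among all denominators up to `n`. -/
structure IsBestApprox (α : ℝ) (n : ℕ) (m : ℤ) : Prop where
  pos : 0 < n
  le : ∀ (j : ℕ) (k : ℤ), 0 < j → j ≤ n → |n * α - m| ≤ |j * α - k|

theorem exists_isBestApprox (α : ℝ) {ε : ℝ} (hε : 0 < ε) :
    ∃ n m, IsBestApprox α n m ∧ |n * α - m| < ε ∧
      ∀ (j : ℕ) (k : ℤ), 0 < j → j < n → ε ≤ |j * α - k| := by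
  classical
  have hex : ∃ n : ℕ, 0 < n ∧ |n * α - round (n * α)| < ε := by
    obtain ⟨N, hN⟩ := exists_nat_one_div_lt hε
    obtain ⟨n, hn, -, hle⟩ := Real.exists_nat_abs_mul_sub_round_le α N.succ_pos
    refine ⟨n, hn, hle.trans_lt (lt_of_le_of_lt ?_ hN)⟩
    push_cast
    gcongr
    linarith
  obtain ⟨hpos, hlt⟩ := Nat.find_spec hex
  have hmin (j : ℕ) (k : ℤ) (hj : 0 < j) (hjn : j < Nat.find hex) : ε ≤ |j * α - k| := by
    have := Nat.find_min hex hjn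
    push Not at this
    exact (this hj).trans (round_le _ _)
  refine ⟨Nat.find hex, round (Nat.find hex * α), ⟨hpos, fun j k hj hjn => ?_⟩, hlt, hmin⟩
  rcases hjn.eq_or_lt with rfl | hjn
  · exact round_le _ _
  · exact hlt.le.trans (hmin j k hj hjn)

theorem natCast_mul_sub_intCast_ne_zero (hα : Irrational α) {n : ℕ} (hn : 0 < n) (m : ℤ) :
    n * α - m ≠ 0 :=
  ((hα.natCast_mul hn.ne').sub_intCast m).ne_zero

/-- Two consecutive best approximations lie on different sides of `α`, since otherwise their
difference would be a better one. -/
theorem exists_isBestApprox_lt (hα : Irrational α) {ε : ℝ} (hε : 0 < ε) :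
    ∃ n m, IsBestApprox α n m ∧ n * α < m ∧ |n * α - m| < ε := by
  obtain ⟨n, m, hn, hnε, -⟩ := exists_isBestApprox α hε
  rcases lt_or_ge (n * α) m with hlt | hge
  · exact ⟨n, m, hn, hlt, hnε⟩
  have herr : 0 < n * α - m :=
    (sub_nonneg.2 hge).lt_of_ne' (natCast_mul_sub_intCast_ne_zero hα hn.pos m)
  obtain ⟨n', m', hn', herr', hmin⟩ := exists_isBestApprox α (abs_pos.2 herr.ne')
  refine ⟨n', m', hn', ?_, herr'.trans hnε⟩
  by_contra! hge'
  have hpos' : 0 < n' * α - m' :=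
    (sub_nonneg.2 hge').lt_of_ne' (natCast_mul_sub_intCast_ne_zero hα hn'.pos m')
  have hnn' : n < n' := not_le.1 fun hle => (hn.le n' m' hn'.pos hle).not_gt herr'
  obtain ⟨d, rfl⟩ := Nat.exists_eq_add_of_lt hnn'
  have hdiff := hmin (d + 1) (m' - m) d.succ_pos (by have := hn.pos; omega)
  rw [abs_of_pos herr, le_abs'] at hdiff
  rw [abs_of_pos hpos', abs_of_pos herr] at herr'
  push_cast at hpos' herr' hdiff
  rcases hdiff with hdiff | hdiff <;> linarith

theorem exists_isBestApprox_ge (hα : Irrational α) (N : ℕ) :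
    ∃ n m, IsBestApprox α n m ∧ n * α < m ∧ N ≤ n := by
  induction N with
  | zero =>
    obtain ⟨n, m, hn, hlt, -⟩ := exists_isBestApprox_lt hα one_pos
    exact ⟨n, m, hn, hlt, n.zero_le⟩
  | succ N ih =>
    obtain ⟨n, m, hn, -, hNn⟩ := ih
    obtain ⟨n', m', hn', hlt', herr⟩ := exists_isBestApprox_lt hα
      (abs_pos.2 (natCast_mul_sub_intCast_ne_zero hα hn.pos m))
    have hnn' : n < n' := not_le.1 fun hle => (hn.le n' m' hn'.pos hle).not_gt herr
    exact ⟨n', m', hn', hlt', by omega⟩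

namespace IsBestApprox

variable {n j : ℕ} {m : ℤ}

theorem floor_le_sub (h : IsBestApprox α n m) (hlt : n * α < m) (hj : 0 < j) (hjn : j ≤ n) :
    ⌊j * α⌋ + (m - n * α) ≤ j * α ∧ j * α + (m - n * α) ≤ ⌊j * α⌋ + 1 := by
  have hbelow := h.le j ⌊j * α⌋ hj hjn
  have habove := h.le j (⌊j * α⌋ + 1) hj hjn
  rw [abs_of_neg (sub_neg.2 hlt)] at hbelow habove
  rw [abs_of_nonneg (sub_nonneg.2 (Int.floor_le _))] at hbelow
  rw [Int.cast_add, Int.cast_one, abs_of_neg (sub_neg.2 (Int.lt_floor_add_one _))] at habove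
  constructor <;> linarith

theorem floor_add_mul (h : IsBestApprox α n m) (hlt : n * α < m) (hj : 0 < j) (hjn : j ≤ n) :
    ⌊(n + j) * α⌋ = m + ⌊j * α⌋ := by
  have := (h.floor_le_sub hlt hj hjn).1
  have := Int.lt_floor_add_one (j * α)
  rw [Int.floor_eq_iff]
  push_cast
  constructor <;> linarith

theorem floor_sub_mul (h : IsBestApprox α n m) (hlt : n * α < m) (hj : 0 < j) (hjn : j ≤ n) :
    ⌊(n - j) * α⌋ = m - ⌊j * α⌋ - 1 := by
  have := (h.floor_le_sub hlt hj hjn).2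
  have := Int.floor_le (j * α)
  rw [Int.floor_eq_iff]
  push_cast
  constructor <;> linarith

theorem prefixSum_add (h : IsBestApprox α n m) (hlt : n * α < m) (hα : 0 ≤ α) (hj : 0 < j)
    {s t : ℕ} (hs : s + j = n) (ht : t = n + j) :
    (prefixSum (mechWord α) s + prefixSum (mechWord α) t : ℤ) = 2 * m - 1 := by
  have hs' : (s : ℝ) = n - j := by rw [← hs]; push_cast; ring
  rw [cast_prefixSum_mechWord hα, cast_prefixSum_mechWord hα, hs', ht, Nat.cast_add,
    h.floor_add_mul hlt hj (by omega), h.floor_sub_mul hlt hj (by omega)]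
  ring

end IsBestApprox

theorem isPalindromicAscent_of_isBestApprox (hα : α ∈ Ioo (0 : ℝ) 1) {n : ℕ} {m : ℤ}
    (h : IsBestApprox α (n + 1) m) (hlt : (n + 1 : ℕ) * α < m) :
    IsPalindromicAscent (mechWord α) n := by
  have hsucc := prefixSum_succ (mechWord α)
  have hcentre : (prefixSum (mechWord α) (n + 1) : ℤ) = m - 1 := by
    have herr := h.le 1 0 one_pos (by omega)
    rw [abs_of_neg (sub_neg.2 hlt), Nat.cast_one, one_mul, Int.cast_zero, sub_zero,
      abs_of_pos hα.1] at herr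
    rw [cast_prefixSum_mechWord hα.1.le, Int.floor_eq_iff]
    push_cast at hlt herr ⊢
    constructor <;> linarith [hα.2]
  have hsum := h.prefixSum_add hlt hα.1.le one_pos (s := n) (t := n + 1 + 1) rfl rfl
  have hbal := isBalancedWord_mechWord hα
  have := hsucc n
  have := hsucc (n + 1)
  have := hbal.le_one n
  have := hbal.le_one (n + 1)
  refine ⟨by omega, by omega, fun s t _ hs hst => ?_⟩
  obtain ⟨j, hj⟩ : ∃ j, s + 1 + j = n + 1 := ⟨n - s, by omega⟩
  have hinner := h.prefixSum_add hlt hα.1.le (j := j) (s := s + 1) (t := t)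
    (by omega) hj (by omega)
  have houter := h.prefixSum_add hlt hα.1.le (j := j + 1) (s := s) (t := t + 1)
    j.succ_pos (by omega) (by omega)
  have := hsucc s
  have := hsucc t
  omega

theorem infinite_isPalindromicAscent_mechWord (hα : α ∈ Ioo (0 : ℝ) 1) (hirr : Irrational α) :
    {m | IsPalindromicAscent (mechWord α) m}.Infinite := by
  refine infinite_of_forall_exists_gt fun N => ?_
  obtain ⟨n, m, hn, hlt, hNn⟩ := exists_isBestApprox_ge hirr (N + 2)
  obtain ⟨n, rfl⟩ : ∃ k, n = k + 1 := ⟨n - 1, by omega⟩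
  exact ⟨n, isPalindromicAscent_of_isBestApprox hα hn hlt, by omega⟩

end MechWord

/-! ### Continued fractions coded by balanced words -/

/-- The pair of partial quotients `c, c` in front of a continued fraction: `s ↦ [0; c, c + s]`. -/
noncomputable def pairMap (c s : ℝ) : ℝ := (c + (c + s)⁻¹)⁻¹

/-- The approximation constant between the two partial quotients of a pair `c, c`, where `s` is
the continued fraction read off in the direction of the second of them, and `t` the one read off
in the opposite direction, starting before the pair. -/
noncomputable def pairConst (c s t : ℝ) : ℝ := c + (c + s)⁻¹ + t

section PairMap

variable {c s t : ℝ}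

theorem strictMonoOn_pairMap (hc : 0 < c) : StrictMonoOn (pairMap c) (Ici 0) := by
  intro s (hs : 0 ≤ s) t (ht : 0 ≤ t) hst
  simp only [pairMap]
  gcongr

theorem abs_pairMap_sub_le (hc : 1 ≤ c) (hs : 0 ≤ s) (ht : 0 ≤ t) :
    |pairMap c s - pairMap c t| ≤ 1 / 4 * |s - t| := by
  have hsub : pairMap c s - pairMap c t = (s - t) / ((c * (c + s) + 1) * (c * (c + t) + 1)) := by
    have : c + s ≠ 0 := by positivity
    have : c + t ≠ 0 := by positivity
    simp only [pairMap]
    field_simp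
    ring
  have hden {u : ℝ} (hu : 0 ≤ u) : 2 ≤ c * (c + u) + 1 := by nlinarith
  rw [hsub, abs_div, div_eq_inv_mul, abs_of_pos (by positivity)]
  gcongr
  rw [one_div]
  gcongr
  nlinarith [hden hs, hden ht]

theorem pairMap_lt_one (hc : 1 ≤ c) (hs : 0 ≤ s) : pairMap c s < 1 :=
  inv_lt_one_of_one_lt₀ (lt_add_of_le_of_pos hc (by positivity))

theorem half_le_pairMap_one (hs : 0 ≤ s) : 1 / 2 ≤ pairMap 1 s := by
  have : (1 + s)⁻¹ ≤ 1 := inv_le_one_of_one_le₀ (by linarith)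
  rw [pairMap, one_div]
  gcongr
  linarith

theorem pairMap_two_lt_half (hs : 0 ≤ s) : pairMap 2 s < 1 / 2 := by
  rw [pairMap, one_div]
  gcongr
  exact lt_add_of_pos_right 2 (by positivity)

theorem two_fifths_le_pairMap_two (hs : 0 ≤ s) : 2 / 5 ≤ pairMap 2 s := by
  have : (2 + s)⁻¹ ≤ 2⁻¹ := by gcongr; linarith
  rw [pairMap, le_inv_comm₀ (by norm_num) (by positivity)]
  linarith

theorem pairMap_two_lt_pairMap_one (hs : 0 ≤ s) (ht : 0 ≤ t) : pairMap 2 s < pairMap 1 t :=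
  (pairMap_two_lt_half hs).trans_le (half_le_pairMap_one ht)

theorem pairConst_one_lt_three (hs : 0 ≤ s) (ht : t ≤ 1) (hst : t < 1 + s) :
    pairConst 1 s t < 3 := by
  rw [pairConst]
  rcases hs.eq_or_lt with rfl | hs
  · rw [add_zero, inv_one]
    linarith
  · have : (1 + s)⁻¹ < 1 := inv_lt_one_of_one_lt₀ (by linarith)
    linarith

theorem pairConst_two (hs : 0 ≤ s) : pairConst 2 s t = 3 + (t - pairMap 1 s) := by
  rw [pairConst, pairMap]
  field_simp
  ring

theorem cmp_pairConst_two (hs : 0 ≤ s) : cmp (pairConst 2 s t) 3 = cmp t (pairMap 1 s) := by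
  rw [pairConst_two hs, ← cmp_sub_zero t, ← cmp_add_left 3 (t - pairMap 1 s) 0, add_zero]

theorem pairConst_two_lt_three (hs : 0 ≤ s) (hst : t < pairMap 1 s) : pairConst 2 s t < 3 :=
  (lt_iff_lt_of_cmp_eq_cmp (cmp_pairConst_two hs)).2 hst

end PairMap

/-- The continued fractions `ℓ i` to the left, read backwards, and `ξ i` to the right of the `i`-th
pair of a sequence of pairs of partial quotients, where the letter `0` of the word `w` stands for
the pair `1, 1`, and the letter `1` for the pair `2, 2`. -/
structure IsPairCoding (w : ℕ → ℕ) (ℓ ξ : ℕ → ℝ) : Prop where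
  left_mem : ∀ i, ℓ i ∈ Icc (0 : ℝ) 1
  right_nonneg : ∀ i, 0 ≤ ξ i
  left_succ : ∀ i, ℓ (i + 1) = pairMap (1 + w i) (ℓ i)
  right_eq : ∀ i, ξ i = pairMap (1 + w i) (ξ (i + 1))

namespace IsPairCoding

variable {w : ℕ → ℕ} {ℓ ξ : ℕ → ℝ} {a J i m : ℕ}

theorem left_nonneg (h : IsPairCoding w ℓ ξ) (i : ℕ) : 0 ≤ ℓ i := (h.left_mem i).1

theorem right_lt_one (h : IsPairCoding w ℓ ξ) (i : ℕ) : ξ i < 1 := by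
  rw [h.right_eq]
  exact pairMap_lt_one (by simp) (h.right_nonneg _)

theorem left_succ_of_zero (h : IsPairCoding w ℓ ξ) (hi : w i = 0) :
    ℓ (i + 1) = pairMap 1 (ℓ i) := by
  simp [h.left_succ, hi]

theorem left_succ_of_one (h : IsPairCoding w ℓ ξ) (hi : w i = 1) :
    ℓ (i + 1) = pairMap 2 (ℓ i) := by
  simp [h.left_succ, hi, one_add_one_eq_two]

theorem right_of_zero (h : IsPairCoding w ℓ ξ) (hi : w i = 0) : ξ i = pairMap 1 (ξ (i + 1)) := by
  simp [h.right_eq i, hi]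

theorem right_of_one (h : IsPairCoding w ℓ ξ) (hi : w i = 1) : ξ i = pairMap 2 (ξ (i + 1)) := by
  simp [h.right_eq i, hi, one_add_one_eq_two]

theorem two_fifths_le_right (h : IsPairCoding w ℓ ξ) (hw : IsBalancedWord w) (i : ℕ) :
    2 / 5 ≤ ξ i := by
  rcases hw.eq_zero_or_one i with hi | hi
  · rw [h.right_of_zero hi]
    linarith [half_le_pairMap_one (h.right_nonneg (i + 1))]
  · rw [h.right_of_one hi]
    exact two_fifths_le_pairMap_two (h.right_nonneg (i + 1))

theorem cmp_of_isMirror (h : IsPairCoding w ℓ ξ) (hm : IsMirror w a J) :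
    cmp (ℓ (a + J)) (ξ (a + J + 2)) = cmp (ℓ a) (ξ (a + 2 * J + 2)) := by
  induction J generalizing a with
  | zero => rfl
  | succ J ih =>
    have hinner := ih hm.inner
    rw [show a + 1 + J = a + (J + 1) by ring, show a + 1 + 2 * J + 2 = a + 2 * J + 3 by ring,
      h.left_succ, h.right_eq (a + 2 * J + 3), ← hm.outer_eq] at hinner
    rw [hinner]
    exact (strictMonoOn_pairMap (by positivity)).cmp_map_eq (h.left_nonneg _) (h.right_nonneg _)

theorem abs_sub_le_of_isMirror (h : IsPairCoding w ℓ ξ) (hm : IsMirror w a J) :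
    |ℓ (a + J) - ξ (a + J + 2)| ≤ (1 / 4) ^ J := by
  suffices |ℓ (a + J) - ξ (a + J + 2)| ≤ (1 / 4) ^ J * |ℓ a - ξ (a + 2 * J + 2)| by
    refine this.trans (mul_le_of_le_one_right (by positivity) (abs_sub_le_iff.2 ⟨?_, ?_⟩))
    · linarith [(h.left_mem a).2, h.right_nonneg (a + 2 * J + 2)]
    · linarith [h.left_nonneg a, h.right_lt_one (a + 2 * J + 2)]
  induction J generalizing a with
  | zero => simp
  | succ J ih =>
    have hinner := ih hm.inner
    rw [show a + 1 + J = a + (J + 1) by ring, show a + 1 + 2 * J + 2 = a + 2 * J + 3 by ring,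
      h.left_succ, h.right_eq (a + 2 * J + 3), ← hm.outer_eq] at hinner
    refine hinner.trans ?_
    rw [pow_succ, mul_assoc]
    gcongr
    exact abs_pairMap_sub_le (by simp) (h.left_nonneg _) (h.right_nonneg _)

theorem left_lt_right_of_ascent (h : IsPairCoding w ℓ ξ) (hw : IsBalancedWord w)
    (h0 : w m = 0) (h1 : w (m + 1) = 1) (hm : ¬ IsPalindromicAscent w m) : ℓ m < ξ (m + 2) := by
  obtain ⟨s, K, rfl, hK, hs, ht⟩ := (hw.mismatch_of_ascent h0 h1).resolve_left hm
  rw [lt_iff_lt_of_cmp_eq_cmp (h.cmp_of_isMirror hK), h.left_succ_of_one hs,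
    show s + 1 + 2 * K + 2 = s + 2 * K + 3 by ring, h.right_of_zero ht]
  exact pairMap_two_lt_pairMap_one (h.left_nonneg _) (h.right_nonneg _)

theorem right_lt_left_of_descent (h : IsPairCoding w ℓ ξ) (hw : IsBalancedWord w)
    (h1 : w m = 1) (h0 : w (m + 1) = 0) : ξ (m + 2) < ℓ m := by
  obtain ⟨s, K, rfl, hK, hs, ht⟩ := hw.mismatch_of_descent h1 h0
  rw [lt_iff_lt_of_cmp_eq_cmp ((cmp_eq_cmp_symm).1 (h.cmp_of_isMirror hK)), h.left_succ_of_zero hs,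
    show s + 1 + 2 * K + 2 = s + 2 * K + 3 by ring, h.right_of_one ht]
  exact pairMap_two_lt_pairMap_one (h.right_nonneg _) (h.left_nonneg _)

theorem pairConst_left_lt_three (h : IsPairCoding w ℓ ξ) (hw : IsBalancedWord w) (i : ℕ) :
    pairConst (1 + w i) (ℓ i) (ξ (i + 1)) < 3 := by
  rcases hw.eq_zero_or_one i with hi | hi
  · rw [hi, Nat.cast_zero, add_zero]
    have hleft := h.left_nonneg i
    have hright := h.right_lt_one (i + 1)
    exact pairConst_one_lt_three hleft hright.le (by linarith)
  · rw [hi, Nat.cast_one, one_add_one_eq_two]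
    refine pairConst_two_lt_three (h.left_nonneg i) ?_
    rcases hw.eq_zero_or_one (i + 1) with hi' | hi'
    · rw [h.right_of_zero hi']
      exact strictMonoOn_pairMap one_pos (h.right_nonneg _) (h.left_nonneg _)
        (h.right_lt_left_of_descent hw hi hi')
    · rw [h.right_of_one hi']
      exact pairMap_two_lt_pairMap_one (h.right_nonneg _) (h.left_nonneg _)

theorem pairConst_right_lt_three (h : IsPairCoding w ℓ ξ) (hw : IsBalancedWord w)
    (hi : ∀ m, IsPalindromicAscent w m → i ≠ m + 1) :
    pairConst (1 + w i) (ξ (i + 1)) (ℓ i) < 3 := by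
  rcases hw.eq_zero_or_one i with hwi | hwi
  · rw [hwi, Nat.cast_zero, add_zero]
    have hleft := (h.left_mem i).2
    have hright := h.two_fifths_le_right hw (i + 1)
    exact pairConst_one_lt_three (h.right_nonneg _) hleft (by linarith)
  · obtain ⟨m, rfl⟩ : ∃ m, i = m + 1 :=
      Nat.exists_eq_succ_of_ne_zero fun h0 => by simp [h0, hw.zero] at hwi
    rw [hwi, Nat.cast_one, one_add_one_eq_two]
    refine pairConst_two_lt_three (h.right_nonneg _) ?_
    rcases hw.eq_zero_or_one m with hm | hm
    · rw [h.left_succ_of_zero hm]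
      exact strictMonoOn_pairMap one_pos (h.left_nonneg _) (h.right_nonneg _)
        (h.left_lt_right_of_ascent hw hm hwi fun hasc => hi m hasc rfl)
    · rw [h.left_succ_of_one hm]
      exact pairMap_two_lt_pairMap_one (h.left_nonneg _) (h.right_nonneg _)

theorem cmp_pairConst_right_of_ascent (h : IsPairCoding w ℓ ξ) (hm : IsPalindromicAscent w m) :
    cmp (pairConst (1 + w (m + 1)) (ξ (m + 2)) (ℓ (m + 1))) 3 = cmp (ℓ 0) (ξ (2 * m + 2)) := by
  rw [hm.2.1, Nat.cast_one, one_add_one_eq_two, cmp_pairConst_two (h.right_nonneg _),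
    h.left_succ_of_zero hm.1,
    (strictMonoOn_pairMap one_pos).cmp_map_eq (h.left_nonneg _) (h.right_nonneg _)]
  simpa only [zero_add] using h.cmp_of_isMirror hm.2.2

theorem abs_pairConst_right_sub_three_le (h : IsPairCoding w ℓ ξ) (hm : IsPalindromicAscent w m) :
    |pairConst (1 + w (m + 1)) (ξ (m + 2)) (ℓ (m + 1)) - 3| ≤ (1 / 4) ^ (m + 1) := by
  rw [hm.2.1, Nat.cast_one, one_add_one_eq_two, pairConst_two (h.right_nonneg _),
    add_sub_cancel_left, h.left_succ_of_zero hm.1, pow_succ']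
  refine (abs_pairMap_sub_le le_rfl (h.left_nonneg _) (h.right_nonneg _)).trans ?_
  gcongr
  simpa only [zero_add] using h.abs_sub_le_of_isMirror hm.2.2

end IsPairCoding

/-- The partial quotients `d` at the positions `0, …, n`, followed by the pairs coded by `w`. -/
def codedQuot (d n : ℕ) (w : ℕ → ℕ) (k : ℕ) : ℕ :=
  if k ≤ n then d else 1 + w ((k - n - 1) / 2)

section CodedQuot

variable {d n : ℕ} {w : ℕ → ℕ} {R : ℕ → ℝ}

theorem codedQuot_of_le {k : ℕ} (hk : k ≤ n) : codedQuot d n w k = d := if_pos hk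

theorem codedQuot_fst (d n : ℕ) (w : ℕ → ℕ) (i : ℕ) :
    codedQuot d n w (n + 2 * i + 1) = 1 + w i := by
  rw [codedQuot, if_neg (by omega), show (n + 2 * i + 1 - n - 1) / 2 = i by omega]

theorem codedQuot_snd (d n : ℕ) (w : ℕ → ℕ) (i : ℕ) :
    codedQuot d n w (n + 2 * i + 2) = 1 + w i := by
  rw [codedQuot, if_neg (by omega), show (n + 2 * i + 2 - n - 1) / 2 = i by omega]

theorem codedQuot_injective (d n : ℕ) : Function.Injective (codedQuot d n) := by
  intro v w hvw
  funext i
  have hi := congrFun hvw (n + 2 * i + 1)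
  rw [codedQuot_fst, codedQuot_fst] at hi
  omega

theorem one_le_codedQuot (hd : 1 ≤ d) (n : ℕ) (w : ℕ → ℕ) (k : ℕ) : 1 ≤ codedQuot d n w k := by
  rw [codedQuot]
  split_ifs <;> omega

theorem IsCompleteQuotients.backQuot_mem_Icc {A : ℕ → ℕ} (h : IsCompleteQuotients A R) (k : ℕ) :
    backQuot A k ∈ Icc (0 : ℝ) 1 := by
  refine ⟨backQuot_nonneg A k, ?_⟩
  cases k with
  | zero => exact zero_le_one
  | succ k =>
    have : (1 : ℝ) ≤ A (k + 1) := by exact_mod_cast h.one_le (k + 1)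
    exact inv_le_one_of_one_le₀ (by linarith [backQuot_nonneg A k])

namespace IsCompleteQuotients

theorem snd_eq_add_inv (h : IsCompleteQuotients (codedQuot d n w) R) (i : ℕ) :
    R (n + 2 * i + 2) = 1 + w i + (R (n + 2 * (i + 1) + 1))⁻¹ := by
  rw [h.eq_add_inv, codedQuot_snd, Nat.cast_add, Nat.cast_one]
  rfl

theorem fst_eq_add_inv (h : IsCompleteQuotients (codedQuot d n w) R) (i : ℕ) :
    R (n + 2 * i + 1) = 1 + w i + (1 + w i + (R (n + 2 * (i + 1) + 1))⁻¹)⁻¹ := by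
  rw [h.eq_add_inv, codedQuot_fst, h.snd_eq_add_inv, Nat.cast_add, Nat.cast_one]

theorem isPairCoding (h : IsCompleteQuotients (codedQuot d n w) R) :
    IsPairCoding w (fun i => backQuot (codedQuot d n w) (n + 2 * i))
      fun i => (R (n + 2 * i + 1))⁻¹ := by
  refine ⟨fun i => h.backQuot_mem_Icc _, fun i => (h.inv_pos _).le, fun i => ?_, fun i => ?_⟩
  · rw [show n + 2 * (i + 1) = n + 2 * i + 1 + 1 by ring, backQuot, backQuot, codedQuot_snd,
      codedQuot_fst, pairMap, Nat.cast_add, Nat.cast_one]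
  · rw [h.fst_eq_add_inv, pairMap]

theorem approxConst_fst (h : IsCompleteQuotients (codedQuot d n w) R) (i : ℕ) :
    approxConst (codedQuot d n w) R (n + 2 * i) =
      pairConst (1 + w i) (R (n + 2 * (i + 1) + 1))⁻¹ (backQuot (codedQuot d n w) (n + 2 * i)) := by
  rw [approxConst, h.fst_eq_add_inv, pairConst]

theorem approxConst_snd (h : IsCompleteQuotients (codedQuot d n w) R) (i : ℕ) :
    approxConst (codedQuot d n w) R (n + 2 * i + 1) =
      pairConst (1 + w i) (backQuot (codedQuot d n w) (n + 2 * i)) (R (n + 2 * (i + 1) + 1))⁻¹ := by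
  rw [approxConst, h.snd_eq_add_inv, backQuot, codedQuot_fst, pairConst, Nat.cast_add,
    Nat.cast_one, add_right_comm]

theorem approxConst_lt_three (h : IsCompleteQuotients (codedQuot d n w) R)
    (hw : IsBalancedWord w) {k : ℕ} (hk : n ≤ k)
    (hasc : ∀ m, IsPalindromicAscent w m → k ≠ n + 2 * (m + 1)) :
    approxConst (codedQuot d n w) R k < 3 := by
  obtain ⟨j, rfl⟩ := Nat.exists_eq_add_of_le hk
  obtain ⟨i, rfl | rfl⟩ := j.even_or_odd'
  · rw [h.approxConst_fst]
    exact h.isPairCoding.pairConst_right_lt_three hw fun m hm him => hasc m hm (by rw [him])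
  · rw [← add_assoc, h.approxConst_snd]
    exact h.isPairCoding.pairConst_left_lt_three hw i

theorem abs_approxConst_sub_three_le (h : IsCompleteQuotients (codedQuot d n w) R) {m : ℕ}
    (hm : IsPalindromicAscent w m) :
    |approxConst (codedQuot d n w) R (n + 2 * (m + 1)) - 3| ≤ (1 / 4) ^ (m + 1) := by
  rw [h.approxConst_fst]
  exact h.isPairCoding.abs_pairConst_right_sub_three_le hm

theorem cmp_approxConst_three (h : IsCompleteQuotients (codedQuot d n w) R) {m : ℕ}
    (hm : IsPalindromicAscent w m) :
    cmp (approxConst (codedQuot d n w) R (n + 2 * (m + 1))) 3 =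
      cmp (backQuot (codedQuot d n w) n) (R (n + 2 * (2 * m + 2) + 1))⁻¹ := by
  rw [h.approxConst_fst]
  exact h.isPairCoding.cmp_pairConst_right_of_ascent hm

theorem lagrangeValue_eq_three (h : IsCompleteQuotients (codedQuot d n w) R)
    (hw : IsBalancedWord w) (hinf : {m | IsPalindromicAscent w m}.Infinite) :
    lagrangeValue (R 0) = 3 := by
  have hclose {ε : ℝ} (hε : 0 < ε) : ∃ M, ∀ m ≥ M, IsPalindromicAscent w m →
      |approxConst (codedQuot d n w) R (n + 2 * (m + 1)) - 3| < ε := by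
    obtain ⟨M, hM⟩ := exists_pow_lt_of_lt_one hε (by norm_num : (1 / 4 : ℝ) < 1)
    refine ⟨M, fun m hMm hm => (h.abs_approxConst_sub_three_le hm).trans_lt (lt_of_le_of_lt ?_ hM)⟩
    exact pow_le_pow_of_le_one (by norm_num) (by norm_num) (by omega)
  refine h.lagrangeValue_eq (c := 3) (by norm_num) (fun b hb => ?_) fun b hb => ?_
  · obtain ⟨M, hM⟩ := hclose (sub_pos.2 hb)
    refine infinite_of_forall_exists_gt fun N => ?_
    obtain ⟨m, hm, hmN⟩ := hinf.exists_gt (max M N)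
    rw [max_lt_iff] at hmN
    have hlt : b < approxConst (codedQuot d n w) R (n + 2 * (m + 1)) := by
      linarith [(abs_lt.1 (hM m hmN.1.le hm)).1]
    exact ⟨_, hlt, by omega⟩
  · obtain ⟨M, hM⟩ := hclose (sub_pos.2 hb)
    refine (finite_lt_nat (n + 2 * (M + 1))).subset fun k (hk : b < _) => ?_
    refine mem_ofPred.2 (not_le.1 fun hkM => ?_)
    refine (h.approxConst_lt_three hw (by omega) ?_).not_gt (lt_trans hb hk)
    rintro m hm rfl
    linarith [(abs_lt.1 (hM m (by omega) hm)).2]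

theorem infinite_ratSolutions_three (h : IsCompleteQuotients (codedQuot d n w) R)
    (hinf : {m | IsPalindromicAscent w m}.Infinite) (hone : 1 ≤ backQuot (codedQuot d n w) n) :
    (ratSolutions 3 (R 0)).Infinite := by
  rw [h.infinite_ratSolutions_iff (by norm_num)]
  refine infinite_of_forall_exists_gt fun N => ?_
  obtain ⟨m, hm, hmN⟩ := hinf.exists_gt N
  refine ⟨n + 2 * (m + 1), ?_, by omega⟩
  refine (lt_iff_lt_of_cmp_eq_cmp (cmp_eq_cmp_symm.1 (h.cmp_approxConst_three hm))).2 ?_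
  exact (h.inv_lt_one _).trans_le hone

theorem encard_ratSolutions_three (h : IsCompleteQuotients (codedQuot d n w) R) (hd : 3 ≤ d)
    (hw : IsBalancedWord w) : (ratSolutions 3 (R 0)).encard = n := by
  have hlarge (k : ℕ) (hk : k < n) : 3 < approxConst (codedQuot d n w) R k := by
    have hd' : (3 : ℝ) ≤ d := by exact_mod_cast hd
    rw [approxConst, h.eq_add_inv, codedQuot_of_le hk]
    linarith [h.inv_pos (k + 2), backQuot_nonneg (codedQuot d n w) k]
  have hback : backQuot (codedQuot d n w) n < 2 / 5 := by
    cases n with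
    | zero => norm_num [backQuot]
    | succ n =>
      have hd' : (3 : ℝ) ≤ d := by exact_mod_cast hd
      have := backQuot_nonneg (codedQuot d (n + 1) w) n
      rw [backQuot, codedQuot_of_le le_rfl, inv_lt_comm₀ (by positivity) (by norm_num)]
      linarith
  have hsmall (k : ℕ) (hk : n ≤ k) : approxConst (codedQuot d n w) R k < 3 := by
    by_cases hasc : ∃ m, IsPalindromicAscent w m ∧ k = n + 2 * (m + 1)
    · obtain ⟨m, hm, rfl⟩ := hasc
      exact (lt_iff_lt_of_cmp_eq_cmp (h.cmp_approxConst_three hm)).2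
        (hback.trans_le (h.isPairCoding.two_fifths_le_right hw (2 * m + 2)))
    · exact h.approxConst_lt_three hw hk fun m hm hkm => hasc ⟨m, hm, hkm⟩
  have hset : {k | 3 < approxConst (codedQuot d n w) R k} = Iio n := by
    ext k
    exact ⟨fun hk => not_le.1 fun hnk => (hsmall k hnk).not_gt hk, hlarge k⟩
  rw [h.encard_ratSolutions (by norm_num), hset, ← Finset.coe_Iio, encard_coe_eq_coe_finsetCard,
    Nat.card_Iio]

end IsCompleteQuotients

end CodedQuot

theorem not_countable_irrational_inter_Ioo : ¬ ({α : ℝ | Irrational α} ∩ Ioo 0 1).Countable := by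
  intro hcount
  have hIoo : (Ioo (0 : ℝ) 1).Countable :=
    (hcount.union (countable_range ((↑) : ℚ → ℝ))).mono fun x hx =>
      (em (x ∈ range ((↑) : ℚ → ℝ))).symm.imp (fun hirr => ⟨hirr, hx⟩) id
  rw [← Cardinal.le_aleph0_iff_set_countable, Cardinal.mk_Ioo_real one_pos] at hIoo
  exact Cardinal.aleph0_lt_continuum.not_ge hIoo

theorem not_countable_of_codedQuot_mechWord {d n : ℕ} (hd : 1 ≤ d) {S : Set ℝ}
    (hS : ∀ α ∈ Ioo (0 : ℝ) 1, Irrational α →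
      ∀ R, IsCompleteQuotients (codedQuot d n (mechWord α)) R → R 0 ∈ S) : ¬ S.Countable := by
  intro hcount
  choose R hR using fun α => exists_isCompleteQuotients (one_le_codedQuot hd n (mechWord α))
  refine not_countable_irrational_inter_Ioo (MapsTo.countable_of_injOn (f := fun α => R α 0)
    (fun α hα => hS α hα.2 hα.1 (R α) (hR α)) (fun α hα β hβ h0 => ?_) hcount)
  exact mechWord_injOn hα.2.1.le hβ.2.1.le
    (codedQuot_injective d n ((hR α).eq_of_zero_eq (hR β) h0))

theorem not_countable_exactSolSet (n : ℕ∞) : ¬ (exactSolSet n).Countable := by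
  cases n with
  | top =>
    refine not_countable_of_codedQuot_mechWord (d := 1) (n := 1) le_rfl fun α hα hirr R h => ?_
    have hasc := infinite_isPalindromicAscent_mechWord hα hirr
    have hone : 1 ≤ backQuot (codedQuot 1 1 (mechWord α)) 1 := by
      simp [backQuot, codedQuot_of_le]
    exact ⟨h.irrational, h.lagrangeValue_eq_three (isBalancedWord_mechWord hα) hasc,
      encard_eq_top (h.infinite_ratSolutions_three hasc hone)⟩
  | coe n =>
    refine not_countable_of_codedQuot_mechWord (d := 3) (n := n) (by norm_num)
      fun α hα hirr R h => ?_
    have hw := isBalancedWord_mechWord hα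
    exact ⟨h.irrational,
      h.lagrangeValue_eq_three hw (infinite_isPalindromicAscent_mechWord hα hirr),
      h.encard_ratSolutions_three le_rfl hw⟩

theorem theorem1 :
    (∀ n : ℕ∞, ¬ (exactSolSet n).Countable) ∧ ¬ (finSolSet 3).Countable := by
  have hsubset : exactSolSet 0 ⊆ finSolSet 3 := fun x ⟨hirr, _, hcard⟩ =>
    ⟨hirr, finite_of_encard_eq_coe (k := 0) hcard⟩
  exact ⟨not_countable_exactSolSet,
    fun hcount => not_countable_exactSolSet 0 (hcount.mono hsubset)⟩
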